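/- Let $p$ be a prime. A commutative pro-$p$ ring is a compact Hausdorff commutative topological ring in which the open ideals of $p$-power index form a basis of neighbourhoods of $0$ (equivalently, an inverse limit of finite rings of $p$-power order). Let $R$ be a commutative Noetherian local pro-$p$ domain with maximal ideal $\mathfrak m$, let $W$ be a finitely generated torsion-free $R$-module, and give $\operatorname{Aut}_R(W)$ its natural topology, in which the congruence subgroups $\{g : gw\equiv w \bmod \mathfrak m^kW \text{ for all } w\in W\}$, $k\ge 0$, form a basis of neighbourhoods of $1$. For a commutative topological ring $S$, call a subgroup $G\le\operatorname{Aut}_R(W)$ *$S$-linear* if for some $n\ge 0$ there is an injective group homomorphism $\rho\colon G\to \mathrm{GL}_n(S)$ that is a homeomorphism onto its image, where this image is closed in $\mathrm{GL}_n(S)$ whenever $G$ is closed in $\operatorname{Aut}_R(W)$. Then for every subgroup $G\le \operatorname{Aut}_R(W)$ there is a commutative Noetherian local pro-$p$ domain $S$ with $\operatorname{char} S=\operatorname{char} R$ and $\dim S=\dim R$ (Krull dimension) such that $G$ is $S$-linear. Moreover, if $R$ is a regular local ring, then one can take $S=R$: every such $G$ is $R$-linear. -/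

import Mathlib

open Topology IsLocalRing

universe u v

/-- `R` is a pro-`p` ring: a compact Hausdorff topological ring in which the open ideals of
`p`-power index form a basis of neighbourhoods of zero; equivalently, `R` is topologically an
inverse limit of finite discrete rings of `p`-power order. -/
structure IsProPRing (p : ℕ) (R : Type*) [CommRing R] [TopologicalSpace R] : Prop where
  isTopologicalRing : IsTopologicalRing R
  compactSpace : CompactSpace R
  t2Space : T2Space R
  exists_open_ideal : ∀ U ∈ 𝓝 (0 : R), ∃ I : Ideal R,
    IsOpen (I : Set R) ∧ (I : Set R) ⊆ U ∧ ∃ k : ℕ, Nat.card (R ⧸ I) = p ^ k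

/-- A commutative Noetherian local pro-`p` domain. -/
structure IsNoetherianLocalProPDomain (p : ℕ) (R : Type*) [CommRing R] [TopologicalSpace R] :
    Prop where
  isDomain : IsDomain R
  isLocalRing : IsLocalRing R
  isNoetherianRing : IsNoetherianRing R
  isProPRing : IsProPRing p R

/-- The natural topology on `Aut_R(W)` for a finitely generated module `W` over a Noetherian
local ring `R` with maximal ideal `𝔪`: pointwise convergence on `W`, where `W` has its `𝔪`-adic
topology. As `W` is finitely generated, the congruence subgroups
`{g | ∀ w, g w - w ∈ 𝔪 ^ k W}` form a basis of neighbourhoods of the identity. -/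
instance linearAutTopology (R W : Type*) [CommRing R] [IsLocalRing R] [AddCommGroup W]
    [Module R W] : TopologicalSpace (W ≃ₗ[R] W) :=
  TopologicalSpace.induced (fun (g : W ≃ₗ[R] W) (w : W) => g w)
    (@Pi.topologicalSpace W (fun _ => W) (fun _ => (maximalIdeal R).adicModuleTopology W))

/-- The subgroup `G` of the topological group `A` is linear over the topological ring `S`: for
some `n` there is an injective homomorphism from `G` to `GL_n(S)` that is a homeomorphism onto its
image, and this image is closed in `GL_n(S)` if `G` is closed in `A`. -/
def IsLinearOver {A : Type*} [Group A] [TopologicalSpace A] (G : Subgroup A)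
    (S : Type*) [CommRing S] [TopologicalSpace S] : Prop :=
  ∃ (n : ℕ) (ρ : G →* Matrix.GeneralLinearGroup (Fin n) S),
    IsEmbedding ρ ∧ (IsClosed (G : Set A) → IsClosed (Set.range ρ))

/-! The proof shows that `S = R` always works, regular or not. It suffices to find coordinates `lam
: W → R^s`, injective, additive and continuous, in which every `R`-endomorphism of `W` acts through
a matrix over `R`. Then `Aut_R(W)`, being compact, embeds as a closed subgroup of `GL_s(R)`.

When `R` is not a field, it is finite over a power series ring `A = C[[X_1, …, X_n]]`, where `C` is
a discrete valuation ring inside `R`. Over `A` the module `W` is still finitely generated and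
torsion-free, so it embeds in `A^s` with image containing `c A^s` for some `c ≠ 0`, but it need not
be free. The coordinates are not linear over the inclusion of `A` in `R`; they are semilinear over
another injection `φ : A → R`. A translation of the variables makes the constant term `c₀` of `c`
nonzero, and scaling the variables by `ϖ c₀` then makes `φ` agree with the evaluation `ev : A → C`
modulo `c₀ 𝔪`.

The image of `W` in `C^s` under `ev` is free of rank `s`, since `C` is a principal ideal domain, and
it contains `c₀ C^s`. A perturbation in `c₀ 𝔪` changes a basis of it only by an invertible matrix `1
+ N`, with `N` having entries in `𝔪`. Hence the `R`-span of `φ(W)` is free as well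
(`exists_semilinear_coordinates`), and a basis of it coming from elements of `W` gives the matrices.
-/

/-! ### Weights on exponents -/

/-- Weights isolating the lexicographically least element of a nonempty set of exponents. -/
theorem exists_weight_unique_minimizer {n : ℕ} (S : Set (Fin n → ℕ)) (hS : S.Nonempty) :
    ∃ α ∈ S, ∃ e : Fin n → ℕ, (∀ i, 0 < e i) ∧ (∀ i : Fin n, i.val + 1 = n → e i = 1) ∧
      ∀ β ∈ S, β ≠ α → ∑ i, e i * α i < ∑ i, e i * β i := by
  induction n with
  | zero =>
    obtain ⟨α, hα⟩ := hS
    exact ⟨α, hα, fun _ => 1, fun i => i.elim0, fun i => i.elim0,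
      fun β _ h => absurd (Subsingleton.elim β α) h⟩
  | succ n ih =>
    classical
    have hex : ∃ a, ∃ α ∈ S, α 0 = a := ⟨_, hS.some, hS.some_mem, rfl⟩
    let a := Nat.find hex
    have hmin : ∀ β ∈ S, a ≤ β 0 := fun β hβ => Nat.find_min' hex ⟨β, hβ, rfl⟩
    obtain ⟨α₀, hα₀, h0⟩ := Nat.find_spec hex
    obtain ⟨α, hα, e, he, he1, hlt⟩ := ih {t | (Fin.cons a t : Fin (n + 1) → ℕ) ∈ S}
      ⟨Fin.tail α₀, by
        have : (Fin.cons a (Fin.tail α₀) : Fin (n + 1) → ℕ) = α₀ := by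
          change (Fin.cons (Nat.find hex) (Fin.tail α₀) : Fin (n + 1) → ℕ) = α₀
          rw [← h0]; exact Fin.cons_self_tail α₀
        simpa [this] using hα₀⟩
    -- The first weight exceeds the weighted sum of the tail of `α`, so raising the first exponent
    -- by one outweighs that whole tail. For `n = 0` the sum is empty and this weight is `1`, as the
    -- last weight must be.
    refine ⟨Fin.cons a α, hα, Fin.cons (∑ i, e i * α i + 1) e, ?_, ?_, ?_⟩
    · intro i
      refine Fin.cases ?_ (fun i => ?_) i
      · simp
      · simpa using he i
    · intro i
      refine Fin.cases ?_ (fun i => ?_) i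
      · intro h
        obtain rfl : n = 0 := by simpa using h.symm
        simp
      · intro h
        simpa using he1 i (by simpa using h)
    · intro β hβ hne
      rw [Fin.sum_univ_succ, Fin.sum_univ_succ]
      simp only [Fin.cons_zero, Fin.cons_succ]
      rcases (hmin β hβ).lt_or_eq with h | h
      · have : (∑ i, e i * α i + 1) * (a + 1) ≤ (∑ i, e i * α i + 1) * β 0 :=
          Nat.mul_le_mul_left _ h
        nlinarith [Nat.zero_le (∑ i : Fin n, e i * β i.succ)]
      · have hb : (Fin.cons a (Fin.tail β) : Fin (n + 1) → ℕ) = β := by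
          rw [h]; exact Fin.cons_self_tail β
        have := hlt (Fin.tail β) (by simpa [hb] using hβ) (by
          rintro rfl; exact hne hb.symm)
        rw [← h]
        simpa [Fin.tail] using this

/-! ### Torsion-free modules and semilinear coordinates -/

/-- A finitely generated torsion-free module over a domain embeds in a free module of the same
rank. -/
theorem exists_injective_into_free (A W : Type*) [CommRing A] [IsDomain A] [AddCommGroup W]
    [Module A W] [Module.Finite A W] [Module.IsTorsionFree A W] :
    ∃ (s : ℕ) (θ : W →ₗ[A] (Fin s → A)) (c : A), Function.Injective θ ∧ c ≠ 0 ∧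
      ∀ i, ∃ w, θ w = Pi.single i c := by
  classical
  obtain ⟨n, v, hv⟩ := Module.Finite.exists_fin (R := A) (M := W)
  obtain ⟨I, hI, hmax⟩ := exists_maximal_linearIndepOn A v
  have hex : ∀ i, ∃ a : A, a ≠ 0 ∧ a • v i ∈ Submodule.span A (v '' I) := by
    intro i
    by_cases hi : i ∈ I
    · exact ⟨1, one_ne_zero, by
        rw [one_smul]; exact Submodule.subset_span (Set.mem_image_of_mem v hi)⟩
    · exact hmax i hi
  choose a ha0 ha using hex
  set c := ∏ i, a i
  have hc : c ≠ 0 := Finset.prod_ne_zero_iff.mpr fun i _ => ha0 i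
  have hcW : ∀ w : W, c • w ∈ Submodule.span A (v '' I) := by
    intro w
    have hw : w ∈ Submodule.span A (Set.range v) := hv ▸ Submodule.mem_top
    induction hw using Submodule.span_induction with
    | mem x hx =>
      obtain ⟨i, rfl⟩ := hx
      rw [show c = (∏ j ∈ Finset.univ.erase i, a j) * a i from
        (Finset.prod_erase_mul _ _ (Finset.mem_univ i)).symm, mul_smul]
      exact Submodule.smul_mem _ _ (ha i)
    | zero => simp
    | add x y _ _ hx hy => rw [smul_add]; exact add_mem hx hy
    | smul b x _ hx => rw [smul_comm]; exact Submodule.smul_mem _ _ hx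
  have hr : Submodule.span A (v '' I) = Submodule.span A (Set.range fun i : I => v i) := by
    rw [Set.image_eq_range]
  let e : Fin (Fintype.card I) ≃ I := (Fintype.equivFin I).symm
  have hli : LinearIndependent A fun i : I => v i := hI
  let b : Module.Basis I A _ := Module.Basis.span hli
  let m : W →ₗ[A] Submodule.span A (Set.range fun i : I => v i) :=
    LinearMap.codRestrict _ (LinearMap.lsmul A W c) fun w => hr ▸ hcW w
  -- `θ w` is the coordinate vector of `c • w` in the maximal independent family, so each member of
  -- the family goes to `c` times a unit vector.
  refine ⟨Fintype.card I, (LinearMap.funLeft A A e).comp (b.equivFun.toLinearMap.comp m), c,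
    ?_, hc, ?_⟩
  · intro x y hxy
    have h1 : b.equivFun (m x) = b.equivFun (m y) :=
      (LinearMap.funLeft_injective_of_surjective A A e e.surjective) hxy
    have h2 : c • x = c • y := congrArg Subtype.val (b.equivFun.injective h1)
    exact smul_right_injective W hc h2
  · intro i
    refine ⟨v (e i), ?_⟩
    have : m (v (e i)) = c • b (e i) := by
      apply Subtype.ext
      simp [m, b, Module.Basis.span_apply]
    ext j
    simp only [LinearMap.comp_apply, LinearEquiv.coe_coe, this, map_smul,
      LinearMap.funLeft_apply, Pi.smul_apply, Module.Basis.equivFun_apply, Module.Basis.repr_self,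
      Finsupp.single_apply, Pi.single_apply, e.injective.eq_iff, smul_eq_mul]
    by_cases h : i = j <;> simp [h, eq_comm]

theorem Matrix.isUnit_one_add_of_forall_mem_maximalIdeal {R : Type*} [CommRing R] [IsLocalRing R]
    {s : Type*} [Fintype s] [DecidableEq s] (N : Matrix s s R)
    (hN : ∀ i j, N i j ∈ maximalIdeal R) : IsUnit (1 + N) := by
  rw [Matrix.isUnit_iff_isUnit_det, ← IsLocalRing.residue_ne_zero_iff_isUnit, RingHom.map_det]
  have : (residue R).mapMatrix (1 + N) = 1 := by
    rw [map_add, map_one, add_eq_left]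
    ext i j
    exact (residue_eq_zero_iff (N i j)).mpr (hN i j)
  rw [this]
  simp

/-- Base change along `φ` (with torsion removed) makes a torsion-free module free, as soon as `φ`
is close enough to a homomorphism factoring through a principal ideal domain `C`. -/
theorem exists_semilinear_coordinates {A C R W : Type*} [CommRing A] [IsDomain A] [CommRing C]
    [IsDomain C] [IsPrincipalIdealRing C] [CommRing R] [IsDomain R] [IsLocalRing R]
    [AddCommGroup W] [Module A W] [Module.Finite A W] [Module.IsTorsionFree A W]
    (j : C →+* R) (hj : Function.Injective j) (P : (A →+* R) → Prop)
    (H : ∀ c : A, c ≠ 0 → ∃ (ev : A →+* C) (φ : A →+* R), Function.Surjective ev ∧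
      Function.Injective φ ∧ P φ ∧ ev c ≠ 0 ∧
      ∀ f, ∃ z ∈ maximalIdeal R, φ f = j (ev f) + j (ev c) * z) :
    ∃ (s : ℕ) (φ : A →+* R) (lam : W →+ (Fin s → R)) (l : Fin s → W),
      Function.Injective φ ∧ P φ ∧ (∀ a w, lam (a • w) = φ a • lam w) ∧
      Function.Injective lam ∧ (∀ i, lam (l i) = Pi.single i 1) ∧
      ∀ w, ∃ b : A, b ≠ 0 ∧ ∃ x : Fin s → A, b • w = ∑ i, x i • l i := by
  classical
  obtain ⟨s, θ, c, hθ, hc, hcθ⟩ := exists_injective_into_free A W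
  obtain ⟨ev, φ, hev, hφ, hP, hevc, happ⟩ := H c hc
  let V : Submodule C (Fin s → C) :=
    { carrier := Set.range fun w : W => ev ∘ θ w
      zero_mem' := ⟨0, by ext; simp⟩
      add_mem' := by
        rintro _ _ ⟨w, rfl⟩ ⟨w', rfl⟩
        exact ⟨w + w', by ext; simp⟩
      smul_mem' := by
        rintro k _ ⟨w, rfl⟩
        obtain ⟨a, rfl⟩ := hev k
        exact ⟨a • w, by ext; simp⟩ }
  have hV : ∀ w, ev ∘ θ w ∈ V := fun w => ⟨w, rfl⟩
  have hVc : ∀ x : Fin s → C, ev c • x ∈ V := by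
    intro x
    rw [← Finset.univ_sum_single x, Finset.smul_sum]
    refine sum_mem fun i _ => ?_
    obtain ⟨w, hw⟩ := hcθ i
    have : ev c • (Pi.single i (x i) : Fin s → C) = x i • (ev ∘ θ w) := by
      ext k
      rw [hw]
      by_cases h : k = i
      · subst h; simp [mul_comm]
      · simp [h]
    rw [this]
    exact V.smul_mem _ (hV w)
  have hrank : Module.finrank C V = s := by
    apply le_antisymm
    · simpa using Submodule.finrank_le V
    · have := LinearMap.finrank_le_finrank_of_injective
        (f := LinearMap.codRestrict V (LinearMap.lsmul C (Fin s → C) (ev c)) hVc)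
        (fun x y hxy => smul_right_injective _ hevc (congrArg Subtype.val hxy))
      simpa using this
  let b : Module.Basis (Fin s) C V := Module.finBasisOfFinrankEq C V hrank
  have hl : ∀ k, ∃ w : W, ev ∘ θ w = b k := fun k => (b k).2
  choose l hl using hl
  let B : Matrix (Fin s) (Fin s) A := Matrix.of fun i k => θ (l k) i
  -- The columns of `P = ev(B)` are the chosen basis of `V`. As `V` contains `ev c • C^s`, there is
  -- `Q` with `P Q = ev c`.
  have hcol : ∀ v ∈ V, ∃ x, v = (ev.mapMatrix B).mulVec x := by
    intro v hv
    refine ⟨b.repr ⟨v, hv⟩, ?_⟩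
    have := congrArg Subtype.val (b.sum_repr ⟨v, hv⟩)
    refine this.symm.trans ?_
    ext i
    simp only [Submodule.coe_sum, Submodule.coe_smul, Finset.sum_apply, Pi.smul_apply,
      Matrix.mulVec, dotProduct, RingHom.mapMatrix_apply, Matrix.map_apply, B, Matrix.of_apply,
      ← hl, Function.comp_apply, smul_eq_mul]
    exact Finset.sum_congr rfl fun k _ => mul_comm _ _
  choose q hq using fun k => hcol _ (hVc (Pi.single k 1))
  let Q : Matrix (Fin s) (Fin s) C := Matrix.of fun i k => q k i
  have hPQ : ev.mapMatrix B * Q = ev c • 1 := by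
    ext i k
    have := congrFun (hq k) i
    rw [Matrix.mul_apply, Matrix.smul_apply, Matrix.one_apply, ← Pi.single_apply]
    exact this.symm
  have hPQR : j.mapMatrix (ev.mapMatrix B) * j.mapMatrix Q = j (ev c) • 1 := by
    rw [← map_mul, hPQ]
    ext i k
    by_cases h : i = k <;> simp [h]
  choose z hzm hz using happ
  let Z : Matrix (Fin s) (Fin s) R := Matrix.of fun i k => z (B i k)
  -- The error `ev(c) Z` equals `P Q Z`, so it is absorbed on the right of `P`.
  have hfac : φ.mapMatrix B = j.mapMatrix (ev.mapMatrix B) * (1 + j.mapMatrix Q * Z) := by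
    rw [mul_add, mul_one, ← mul_assoc, hPQR, Matrix.smul_mul, one_mul]
    ext i k
    simpa [Z] using hz (B i k)
  have hunit : IsUnit (1 + j.mapMatrix Q * Z) := by
    refine Matrix.isUnit_one_add_of_forall_mem_maximalIdeal _ fun i k => ?_
    rw [Matrix.mul_apply]
    exact sum_mem fun t _ => Ideal.mul_mem_left _ _ (hzm _)
  obtain ⟨U, hU⟩ := hunit
  have hdetP : (j.mapMatrix (ev.mapMatrix B)).det ≠ 0 := by
    intro h0
    have := congrArg Matrix.det hPQR
    rw [Matrix.det_mul, h0, zero_mul, Matrix.det_smul, Matrix.det_one, mul_one] at this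
    exact hevc (hj (by rw [map_zero]; exact eq_zero_of_pow_eq_zero this.symm))
  have hdet : (φ.mapMatrix B).det ≠ 0 := by
    rw [hfac, Matrix.det_mul]
    refine mul_ne_zero hdetP ?_
    rw [← hU]
    exact ((Matrix.isUnit_iff_isUnit_det _).mp U.isUnit).ne_zero
  have hinj := Matrix.mulVec_injective_of_det_ne_zero hdet
  have hex : ∀ w, ∃ y, φ ∘ θ w = (φ.mapMatrix B).mulVec y := by
    intro w
    obtain ⟨x, hx⟩ := hcol _ (hV w)
    -- With `ev(θ w) = P x`, one has `φ(θ w) = P x + ev(c) z = P (x + Q z)`, while `φ(B) = P U`.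
    refine ⟨((U⁻¹ : (Matrix (Fin s) (Fin s) R)ˣ) : Matrix (Fin s) (Fin s) R).mulVec
      (j ∘ x + (j.mapMatrix Q).mulVec fun i => z (θ w i)), ?_⟩
    rw [hfac, ← hU, Matrix.mulVec_mulVec, mul_assoc, Units.mul_inv, mul_one, Matrix.mulVec_add,
      Matrix.mulVec_mulVec, hPQR, Matrix.smul_mulVec, Matrix.one_mulVec]
    ext i
    have h1 : j (ev (θ w i)) = (j.mapMatrix (ev.mapMatrix B)).mulVec (j ∘ x) i := by
      rw [show ev (θ w i) = _ from congrFun hx i]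
      exact RingHom.map_mulVec j _ _ i
    rw [Pi.add_apply, ← h1]
    exact hz _
  choose lam hlam using hex
  have hcolB : ∀ k, φ ∘ θ (l k) = (φ.mapMatrix B).mulVec (Pi.single k 1) := by
    intro k
    ext i
    simp [B]
  have hlaml : ∀ k, lam (l k) = Pi.single k 1 := fun k => hinj ((hlam _).symm.trans (hcolB k))
  have hlamadd : ∀ w w', lam (w + w') = lam w + lam w' := by
    intro w w'
    apply hinj
    simp only [← hlam, Matrix.mulVec_add]
    ext i
    simp
  refine ⟨s, φ, AddMonoidHom.mk' lam hlamadd, l, hφ, hP, ?_, ?_, hlaml, ?_⟩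
  · intro a w
    apply hinj
    simp only [AddMonoidHom.mk'_apply, ← hlam, Matrix.mulVec_smul]
    ext i
    simp
  · intro w w' hww
    have h : φ ∘ θ w = φ ∘ θ w' := by
      rw [hlam, hlam]; exact congrArg _ hww
    exact hθ (funext fun i => hφ (congrFun h i))
  · intro w
    -- Cramer's rule: `B * adj B = det B`.
    refine ⟨B.det, fun h0 => hdet (by rw [← RingHom.map_det, h0, map_zero]),
      B.adjugate.mulVec (θ w), hθ ?_⟩
    have h1 : B.mulVec (B.adjugate.mulVec (θ w)) = B.det • θ w := by
      rw [Matrix.mulVec_mulVec, Matrix.mul_adjugate, Matrix.smul_mulVec, Matrix.one_mulVec]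
    rw [map_smul, ← h1, map_sum]
    ext i
    simp only [map_smul, Finset.sum_apply, Pi.smul_apply, smul_eq_mul]
    rw [Matrix.mulVec, dotProduct]
    exact Finset.sum_congr rfl fun k _ => mul_comm _ _

/-- The matrix of an endomorphism in the coordinates of `exists_semilinear_coordinates`. -/
theorem semilinear_coordinates_apply {A R W : Type*} [CommRing A] [CommRing R] [IsDomain R]
    [AddCommGroup W] [Module A W] {s : ℕ} {φ : A →+* R} {lam : W →+ (Fin s → R)} {l : Fin s → W}
    (hφ : Function.Injective φ) (hsemi : ∀ a w, lam (a • w) = φ a • lam w)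
    (hl : ∀ i, lam (l i) = Pi.single i 1)
    (hspan : ∀ w, ∃ b : A, b ≠ 0 ∧ ∃ x : Fin s → A, b • w = ∑ i, x i • l i)
    (g : W →ₗ[A] W) (w : W) :
    lam (g w) = (Matrix.of fun i k => lam (g (l k)) i).mulVec (lam w) := by
  obtain ⟨b, hb, x, hx⟩ := hspan w
  have hb' : φ b ≠ 0 := (map_ne_zero_iff φ hφ).mpr hb
  apply smul_right_injective _ hb'
  have hw : φ b • lam w = φ ∘ x := by
    rw [← hsemi, hx, map_sum]
    ext k
    simp [hsemi, hl, Pi.single_apply]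
  change φ b • lam (g w) = φ b • _
  rw [← Matrix.mulVec_smul, hw, ← hsemi, ← map_smul, hx, map_sum, map_sum]
  ext k
  simp only [map_smul, hsemi, Finset.sum_apply, Pi.smul_apply, smul_eq_mul, Matrix.mulVec,
    dotProduct, Matrix.of_apply, Function.comp_apply]
  exact Finset.sum_congr rfl fun i _ => mul_comm _ _

/-! ### The topology of a Noetherian local pro-`p` ring -/

/-- An open ideal of a compact ring has finite, hence Artinian, quotient, and so contains a power of
the maximal ideal. -/
theorem IsProPRing.isAdic_maximalIdeal {p : ℕ} {R : Type*} [CommRing R] [IsLocalRing R]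
    [IsNoetherianRing R] [TopologicalSpace R] (hR : IsProPRing p R) : IsAdic (maximalIdeal R) := by
  have := hR.isTopologicalRing
  have := hR.compactSpace
  have := hR.t2Space
  refine isAdic_iff.mpr ⟨isOpen_maximalIdeal_pow R, fun U hU => ?_⟩
  obtain ⟨I, hI, hIU, -⟩ := hR.exists_open_ideal U hU
  have := isOpen_iff_finite_quotient.mp hI
  obtain ⟨n, hn⟩ := exists_maximalIdeal_pow_le_of_isArtinianRing_quotient I
  exact ⟨n, fun x hx => hIU (hn hx)⟩

theorem IsProPRing.natCast_mem_maximalIdeal {p : ℕ} {R : Type*} [CommRing R] [IsLocalRing R]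
    [TopologicalSpace R] (hR : IsProPRing p R) : (p : R) ∈ maximalIdeal R := by
  have := hR.t2Space
  obtain ⟨I, -, hIU, k, hk⟩ := hR.exists_open_ideal {1}ᶜ (isOpen_compl_singleton.mem_nhds (by simp))
  have hI : I ≠ ⊤ := fun h => hIU (h ▸ Submodule.mem_top : (1 : R) ∈ I) rfl
  have hpk : (p : R) ^ k ∈ I := by
    rw [← Ideal.Quotient.eq_zero_iff_mem, map_pow, map_natCast, ← Nat.cast_pow, ← hk]
    simpa using card_nsmul_eq_zero' (x := (1 : R ⧸ I))
  exact (inferInstance : (maximalIdeal R).IsPrime).mem_of_pow_mem k (le_maximalIdeal hI hpk)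

theorem IsAdic.isLinearTopology {R : Type*} [CommRing R] [TopologicalSpace R] {J : Ideal R} (hJ : IsAdic J) : IsLinearTopology R R :=
  IsLinearTopology.mk_of_hasBasis _ hJ.hasBasis_nhds_zero

theorem Subring.isLinearTopology {R : Type*} [CommRing R] [TopologicalSpace R]
    [IsLinearTopology R R] (S : Subring R) :
    IsLinearTopology S S := by
  have h := (IsLinearTopology.hasBasis_ideal (R := R)).comap (S.subtype)
  refine IsLinearTopology.mk_of_hasBasis' S (ι := Ideal R) (S := Ideal S)
    (p := fun I => (I : Set R) ∈ 𝓝 0) (s := fun I => I.comap S.subtype) ?_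
    (fun I a m hm => I.mul_mem_left _ hm)
  rw [nhds_subtype_eq_comap]
  exact h

/-! ### A discrete valuation ring inside `R` -/

section coefficientRing

variable {R : Type*} [CommRing R] [TopologicalSpace R] [IsTopologicalRing R]

/-- The closed subring of a topological ring generated by one element. -/
def coefficientSubring (ϖ : R) : Subring R := (Subring.closure {ϖ}).topologicalClosure

theorem mem_coefficientSubring (ϖ : R) : ϖ ∈ coefficientSubring ϖ :=
  Subring.le_topologicalClosure _ (Subring.subset_closure rfl)

theorem closure_le_coefficientSubring (ϖ : R) : Subring.closure {ϖ} ≤ coefficientSubring ϖ :=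
  Subring.le_topologicalClosure _

theorem isClosed_coefficientSubring (ϖ : R) : IsClosed (coefficientSubring ϖ : Set R) :=
  Subring.isClosed_topologicalClosure _

instance [CompactSpace R] (ϖ : R) : CompactSpace (coefficientSubring ϖ) :=
  isCompact_iff_compactSpace.mp (isClosed_coefficientSubring ϖ).isCompact

/-- Polynomials in `ϖ` over the integers have this form because `ϖ` divides `p`; the finitely many
classes involved are compact, so the form survives closure. -/
theorem exists_eq_natCast_add_mul_of_mem_coefficientSubring [CompactSpace R] [T2Space R] {p : ℕ}
    (hp : 0 < p) {ϖ : R} (hpϖ : ∃ d ∈ Subring.closure {ϖ}, (p : R) = ϖ * d) {x : R}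
    (hx : x ∈ coefficientSubring ϖ) :
    ∃ k < p, ∃ d ∈ coefficientSubring ϖ, x = (k : R) + ϖ * d := by
  have hclosed : IsClosed (⋃ k ∈ Finset.range p,
      (fun d => (k : R) + ϖ * d) '' (coefficientSubring ϖ : Set R)) :=
    isClosed_biUnion_finset fun k _ =>
      ((isClosed_coefficientSubring ϖ).isCompact.image (by fun_prop)).isClosed
  have hsub : ((Subring.closure {ϖ} : Subring R) : Set R) ⊆ ⋃ k ∈ Finset.range p,
      (fun d => (k : R) + ϖ * d) '' (coefficientSubring ϖ : Set R) := by
    intro y hy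
    have hint : ∃ (k : ℤ), ∃ d ∈ Subring.closure {ϖ}, y = k + ϖ * d := by
      induction hy using Subring.closure_induction with
      | mem y hy => exact ⟨0, 1, one_mem _, by simpa using hy⟩
      | zero => exact ⟨0, 0, zero_mem _, by simp⟩
      | one => exact ⟨1, 0, zero_mem _, by simp⟩
      | add y z _ _ hy hz =>
        obtain ⟨k, d, hd, rfl⟩ := hy
        obtain ⟨k', d', hd', rfl⟩ := hz
        exact ⟨k + k', d + d', add_mem hd hd', by push_cast; ring⟩
      | neg y _ hy =>
        obtain ⟨k, d, hd, rfl⟩ := hy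
        exact ⟨-k, -d, neg_mem hd, by push_cast; ring⟩
      | mul y z _ _ hy hz =>
        obtain ⟨k, d, hd, rfl⟩ := hy
        obtain ⟨k', d', hd', rfl⟩ := hz
        refine ⟨k * k', k * d' + k' * d + ϖ * d * d', ?_, by push_cast; ring⟩
        exact add_mem (add_mem (mul_mem (intCast_mem _ _) hd') (mul_mem (intCast_mem _ _) hd))
          (mul_mem (mul_mem (Subring.subset_closure rfl) hd) hd')
    obtain ⟨k, d, hd, rfl⟩ := hint
    obtain ⟨d₀, hd₀, hpd⟩ := hpϖ
    have hp' : (0 : ℤ) < p := by exact_mod_cast hp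
    refine Set.mem_biUnion (x := (k % p).toNat) ?_
      ⟨d₀ * ((k / p : ℤ) : R) + d, Subring.le_topologicalClosure _
        (add_mem (mul_mem hd₀ (intCast_mem _ _)) hd), ?_⟩
    · have := Int.emod_lt_of_pos k hp'
      have := Int.emod_nonneg k hp'.ne'
      simp only [Finset.coe_range, Set.mem_Iio]
      omega
    · have h1 : (((k % p).toNat : ℕ) : R) = ((k % p : ℤ) : R) := by
        rw [← Int.cast_natCast, Int.toNat_of_nonneg (Int.emod_nonneg k hp'.ne')]
      have h2 : (k : R) = ((k % p : ℤ) : R) + (p : R) * ((k / p : ℤ) : R) := by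
        conv_lhs => rw [← Int.emod_add_mul_ediv k p]
        push_cast; ring
      change (((k % p).toNat : ℕ) : R) + _ = _
      rw [h1, h2, hpd]; ring
  have := closure_minimal hsub hclosed (show x ∈ closure _ from hx)
  simpa [eq_comm] using this

/-- The multiples of `1 - y` in `S` form a closed set containing every `1 - y ^ n`, and these tend
to `1`. -/
theorem isUnit_one_sub_of_coe_mem_maximalIdeal [IsLocalRing R] [CompactSpace R] [T2Space R]
    (hR : IsAdic (maximalIdeal R)) {S : Subring R} (hS : IsClosed (S : Set R)) (y : S)
    (hy : (y : R) ∈ maximalIdeal R) : IsUnit (1 - y) := by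
  have : CompactSpace S := isCompact_iff_compactSpace.mp hS.isCompact
  have hlim : Filter.Tendsto (fun n : ℕ => 1 - y ^ n) Filter.atTop (𝓝 1) := by
    have : Filter.Tendsto (fun n : ℕ => y ^ n) Filter.atTop (𝓝 0) := by
      rw [nhds_subtype_eq_comap, Filter.tendsto_comap_iff]
      refine (hR.hasBasis_nhds_zero.tendsto_right_iff).mpr fun N _ => ?_
      filter_upwards [Filter.eventually_ge_atTop N] with n hn
      exact Ideal.pow_le_pow_right hn (Ideal.pow_mem_pow hy n)
    simpa using this.const_sub 1
  have hc : IsClosed (Set.range fun z : S => (1 - y) * z) := (isCompact_range (by fun_prop)).isClosed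
  obtain ⟨z, hz⟩ := hc.mem_of_tendsto hlim (Filter.Eventually.of_forall fun n =>
    ⟨∑ i ∈ Finset.range n, y ^ i, mul_neg_geom_sum y n⟩)
  exact .of_mul_eq_one _ hz

theorem isUnit_or_dvd_of_coefficientSubring [IsLocalRing R] [CompactSpace R] [T2Space R] {p : ℕ}
    (hp : p.Prime) (hR : IsAdic (maximalIdeal R)) {ϖ : R} (hϖ : ϖ ∈ maximalIdeal R)
    (hpϖ : ∃ d ∈ Subring.closure {ϖ}, (p : R) = ϖ * d) (x : coefficientSubring ϖ) :
    IsUnit x ∨ (⟨ϖ, mem_coefficientSubring ϖ⟩ : coefficientSubring ϖ) ∣ x := by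
  obtain ⟨k, hk, d, hd, hx⟩ := exists_eq_natCast_add_mul_of_mem_coefficientSubring hp.pos hpϖ x.2
  rcases Nat.eq_zero_or_pos k with rfl | hk0
  · exact Or.inr ⟨⟨d, hd⟩, Subtype.ext (by simpa using hx)⟩
  · left
    have hcop : Nat.Coprime k p := Nat.Coprime.symm (hp.coprime_iff_not_dvd.mpr
      fun h => absurd (Nat.le_of_dvd hk0 h) (not_le.mpr hk))
    -- From `u k + v p = 1` follows `u x = 1 - ϖ (v d₀ - u d)`, a unit.
    obtain ⟨u, v, huv⟩ := Nat.isCoprime_iff_coprime.mpr hcop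
    obtain ⟨d₀, hd₀, hpd⟩ := hpϖ
    have huv' : (u : R) * k + v * p = 1 := by exact_mod_cast congrArg (Int.cast (R := R)) huv
    let t : coefficientSubring ϖ := ⟨ϖ, mem_coefficientSubring ϖ⟩
    let D : coefficientSubring ϖ := ⟨d, hd⟩
    let D₀ : coefficientSubring ϖ := ⟨d₀, closure_le_coefficientSubring ϖ hd₀⟩
    let y : coefficientSubring ϖ := t * (v * D₀ - u * D)
    have h1 : IsUnit (1 - y) := isUnit_one_sub_of_coe_mem_maximalIdeal hR (isClosed_coefficientSubring ϖ) y
      (Ideal.mul_mem_right _ _ hϖ)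
    have h2 : (u : coefficientSubring ϖ) * x = 1 - y := by
      apply Subtype.ext
      have h3 : ((1 - y : coefficientSubring ϖ) : R) = 1 - ϖ * (v * d₀ - u * d) := by
        simp [y, t, D, D₀]
      rw [h3, Subring.coe_mul, Subring.coe_intCast, hx, ← huv', hpd]
      ring
    exact isUnit_of_mul_isUnit_right (h2 ▸ h1)

/-- Every nonunit is divisible by `ϖ`, and by Krull's intersection theorem in `R` a nonzero element
is divisible only finitely often. -/
theorem isDiscreteValuationRing_coefficientSubring [IsDomain R] [IsNoetherianRing R] [IsLocalRing R]
    [CompactSpace R] [T2Space R] {p : ℕ}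
    (hp : p.Prime) (hR : IsAdic (maximalIdeal R)) {ϖ : R} (hϖ : ϖ ∈ maximalIdeal R) (hϖ0 : ϖ ≠ 0)
    (hpϖ : ∃ d ∈ Subring.closure {ϖ}, (p : R) = ϖ * d) :
    IsDiscreteValuationRing (coefficientSubring ϖ) ∧
      Irreducible (⟨ϖ, mem_coefficientSubring ϖ⟩ : coefficientSubring ϖ) := by
  set t : coefficientSubring ϖ := ⟨ϖ, mem_coefficientSubring ϖ⟩
  have ht0 : t ≠ 0 := fun h => hϖ0 (congrArg Subtype.val h)
  have htu : ¬ IsUnit t := fun h => (mem_maximalIdeal _).mp hϖ (h.map (coefficientSubring ϖ).subtype)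
  have hdvd := isUnit_or_dvd_of_coefficientSubring hp hR hϖ hpϖ
  have hirr : Irreducible t := by
    refine ⟨htu, fun a b hab => ?_⟩
    by_contra! h
    obtain ⟨a', ha'⟩ := (hdvd a).resolve_left h.1
    obtain ⟨b', hb'⟩ := (hdvd b).resolve_left h.2
    refine htu (.of_mul_eq_one (a' * b') (mul_left_cancel₀ ht0 ?_))
    rw [mul_one]; conv_rhs => rw [hab, ha', hb']
    ring
  refine ⟨IsDiscreteValuationRing.ofHasUnitMulPowIrreducibleFactorization ⟨t, hirr, ?_⟩, hirr⟩
  intro x hx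
  have hfin : ∃ n, ¬ t ^ n ∣ x := by
    by_contra! h
    have : (x : R) ∈ (⨅ n : ℕ, maximalIdeal R ^ n : Ideal R) := by
      refine (Submodule.mem_iInf _).mpr fun n => ?_
      obtain ⟨y, hy⟩ := h n
      rw [hy]
      exact Ideal.mul_mem_right _ _ (Ideal.pow_mem_pow hϖ n)
    rw [Ideal.iInf_pow_eq_bot_of_isLocalRing _ (Ideal.IsPrime.ne_top inferInstance)] at this
    exact hx (Subtype.ext this)
  obtain ⟨n, hn⟩ := hfin
  obtain ⟨y, hy, hny⟩ := FiniteMultiplicity.exists_eq_pow_mul_and_not_dvd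
    (a := t) (b := x) ⟨n, fun h => hn ((pow_dvd_pow t n.le_succ).trans h)⟩
  exact ⟨_, ((hdvd y).resolve_right hny).unit, hy.symm⟩

end coefficientRing

/-! ### Evaluation and translation of power series -/

section powerSeries

open MvPowerSeries MvPowerSeries.WithPiTopology

variable {C : Type*} [CommRing C] [TopologicalSpace C]

instance MvPowerSeries.compactSpace_of_compactSpace {σ : Type*} [CompactSpace C] :
    CompactSpace (MvPowerSeries σ C) :=
  inferInstanceAs (CompactSpace ((σ →₀ ℕ) → C))

theorem MvPowerSeries.exists_continuous_algHom [IsTopologicalRing C] {S : Type*} [CommRing S]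
    [TopologicalSpace S] [IsTopologicalRing S] [CompactSpace S] [T2Space S] [IsLinearTopology S S]
    [Algebra C S] [ContinuousSMul C S] {σ : Type*} [Finite σ] (a : σ → S)
    (ha : ∀ i, IsTopologicallyNilpotent (a i)) :
    ∃ F : MvPowerSeries σ C →ₐ[C] S, Continuous F ∧ (∀ i, F (X i) = a i) ∧
      ∀ f, HasSum (fun d => coeff d f • d.prod fun i e => a i ^ e) (F f) := by
  let : UniformSpace C := IsTopologicalAddGroup.rightUniformSpace C
  have := isUniformAddGroup_of_addCommGroup (G := C)
  let : UniformSpace S := IsTopologicalAddGroup.rightUniformSpace S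
  have := isUniformAddGroup_of_addCommGroup (G := S)
  have hev : HasEval a := ⟨ha, by simp [Filter.cofinite_eq_bot]⟩
  refine ⟨aeval hev, continuous_aeval hev, fun i => ?_, hasSum_aeval hev⟩
  rw [← MvPolynomial.coe_X, aeval_coe, MvPolynomial.aeval_X]

theorem MvPowerSeries.algHom_ext_of_continuous {S : Type*} [CommRing S] [TopologicalSpace S]
    [T2Space S] [Algebra C S] {σ : Type*} {F G : MvPowerSeries σ C →ₐ[C] S} (hF : Continuous F)
    (hG : Continuous G) (h : ∀ i, F (X i) = G (X i)) : F = G := by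
  have h1 : F.comp (MvPolynomial.coeToMvPowerSeries.algHom C) =
      G.comp (MvPolynomial.coeToMvPowerSeries.algHom C) := by
    refine MvPolynomial.algHom_ext fun i => ?_
    simpa using h i
  refine DFunLike.coe_injective (denseRange_toMvPowerSeries.equalizer hF hG (funext fun p => ?_))
  simpa using DFunLike.congr_fun h1 p

/-- Substituting `X_i + a_i` has a left inverse, the substitution of `X_i - a_i`. -/
theorem MvPowerSeries.exists_translation [IsTopologicalRing C] [CompactSpace C] [T2Space C]
    [IsLinearTopology C C] {σ : Type*} [Finite σ] (a : σ → C)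
    (ha : ∀ i, IsTopologicallyNilpotent (a i)) :
    ∃ ψ : MvPowerSeries σ C →ₐ[C] MvPowerSeries σ C, Continuous ψ ∧ Function.Injective ψ ∧
      ∀ f, HasSum (fun d => coeff d f * d.prod fun i e => a i ^ e) (constantCoeff (ψ f)) := by
  have h1 : ∀ i, IsTopologicallyNilpotent (X i + algebraMap C _ (a i) : MvPowerSeries σ C) :=
    fun i => LinearTopology.isTopologicallyNilpotent_of_constantCoeff
      (by simpa [MvPowerSeries.algebraMap_apply] using ha i)
  have h2 : ∀ i, IsTopologicallyNilpotent (X i - algebraMap C _ (a i) : MvPowerSeries σ C) := by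
    intro i
    refine LinearTopology.isTopologicallyNilpotent_of_constantCoeff ?_
    have : IsTopologicallyNilpotent (-1 * a i) := (ha i).mul_left (-1)
    simpa [MvPowerSeries.algebraMap_apply] using this
  obtain ⟨ψ, hψ, hψX, hsum⟩ := exists_continuous_algHom (C := C) _ h1
  obtain ⟨χ, hχ, hχX, -⟩ := exists_continuous_algHom (C := C) _ h2
  have hid : χ.comp ψ = AlgHom.id C _ := by
    refine algHom_ext_of_continuous (hχ.comp hψ) continuous_id fun i => ?_
    rw [AlgHom.comp_apply, hψX, map_add, hχX, AlgHom.commutes]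
    simp
  refine ⟨ψ, hψ, Function.LeftInverse.injective (g := χ) (DFunLike.congr_fun hid), fun f => ?_⟩
  convert! (hsum f).map (constantCoeff (σ := σ) (R := C)) (continuous_constantCoeff C) with d
  simp [Finsupp.prod, MvPowerSeries.algebraMap_apply]

theorem HasSum.sub_mem_of_isClosed {M ι : Type*} [AddCommGroup M] [TopologicalSpace M]
    [IsTopologicalAddGroup M] {J : AddSubgroup M} (hJ : IsClosed (J : Set M)) {f : ι → M} {x : M}
    (hf : HasSum f x) (i : ι) (h : ∀ k ≠ i, f k ∈ J) : x - f i ∈ J := by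
  classical
  have h1 : Filter.Tendsto (fun s : Finset ι => ∑ k ∈ s, f k - f i) Filter.atTop (𝓝 (x - f i)) :=
    Filter.Tendsto.sub_const hf _
  refine hJ.mem_of_tendsto h1 ?_
  filter_upwards [Filter.eventually_ge_atTop {i}] with s hs
  have hi : i ∈ s := hs (Finset.mem_singleton_self i)
  rw [← Finset.add_sum_erase s f hi, add_sub_cancel_left]
  exact sum_mem fun k hk => h k (Finset.ne_of_mem_erase hk)

/-- A nonzero power series over a compact discrete valuation ring can be translated so as to have
nonzero constant coefficient. -/
theorem MvPowerSeries.exists_translation_constantCoeff_ne_zero [IsDomain C]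
    [IsDiscreteValuationRing C] [IsTopologicalRing C] [CompactSpace C] [T2Space C]
    [IsLinearTopology C C] {ϖ : C} (hϖ : Irreducible ϖ) (hnil : IsTopologicallyNilpotent ϖ) {n : ℕ}
    (f : MvPowerSeries (Fin n) C) (hf : f ≠ 0) :
    ∃ ψ : MvPowerSeries (Fin n) C →ₐ[C] MvPowerSeries (Fin n) C, Continuous ψ ∧
      Function.Injective ψ ∧ constantCoeff (ψ f) ≠ 0 := by
  obtain ⟨d₀, hd₀⟩ : ∃ d, coeff d f ≠ 0 := by
    by_contra! h
    exact hf (MvPowerSeries.ext (by simpa using h))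
  obtain ⟨α, hα, e, he, -, hlt⟩ := exists_weight_unique_minimizer
    {α : Fin n → ℕ | coeff (Finsupp.equivFunOnFinite.symm α) f ≠ 0}
    ⟨d₀, by simpa using hd₀⟩
  set α' := Finsupp.equivFunOnFinite.symm α with hα'
  obtain ⟨v, w, hv⟩ := IsDiscreteValuationRing.eq_unit_mul_pow_irreducible hα hϖ
  have hpos : ∀ i, 0 < (v + 1) * e i := fun i => Nat.mul_pos v.succ_pos (he i)
  -- With `v` the valuation of the coefficient at `α`, its term has valuation `v + N`. Any other
  -- weight is larger by at least one, and the factor `v + 1` turns this into valuation at least `v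
  -- + 1 + N`, so no cancellation occurs.
  obtain ⟨ψ, hψ, hinj, hsum⟩ := exists_translation (fun i => ϖ ^ ((v + 1) * e i)) fun i => by
    obtain ⟨m, hm⟩ := Nat.exists_eq_succ_of_ne_zero (hpos i).ne'
    rw [hm, pow_succ]
    exact hnil.mul_left _
  refine ⟨ψ, hψ, hinj, fun h0 => ?_⟩
  have hprod : ∀ d : Fin n →₀ ℕ, (d.prod fun i k => (ϖ ^ ((v + 1) * e i)) ^ k) =
      ϖ ^ ((v + 1) * ∑ i, e i * d i) := by
    intro d
    rw [Finsupp.prod_fintype _ _ (by simp), Finset.mul_sum, ← Finset.prod_pow_eq_pow_sum]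
    exact Finset.prod_congr rfl fun i _ => by rw [← pow_mul, mul_assoc]
  set N := (v + 1) * ∑ i, e i * α i
  have hclosed : IsClosed ((Ideal.span {ϖ ^ (v + 1 + N)} : Ideal C) : Set C) :=
    (Ideal.isCompact_of_fg (Submodule.fg_span_singleton _)).isClosed
  have hmem := HasSum.sub_mem_of_isClosed (J := (Ideal.span {ϖ ^ (v + 1 + N)}).toAddSubgroup)
    hclosed (hsum f) α' (by
      intro d hd
      rw [hprod]
      by_cases hc : coeff d f = 0
      · rw [hc, zero_mul]; exact zero_mem _
      · have := hlt (Finsupp.equivFunOnFinite d) (by simpa using hc)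
          (fun h => hd (by rw [hα', ← h]; simp))
        refine Ideal.mul_mem_left _ _ (Ideal.mem_span_singleton.mpr (pow_dvd_pow _ ?_))
        have h2 := Nat.mul_le_mul_left (v + 1) (Nat.succ_le_of_lt this)
        simp only [Finsupp.equivFunOnFinite_apply, Nat.succ_eq_add_one, mul_add, mul_one] at h2
        omega)
  rw [h0, zero_sub, hprod, hv] at hmem
  have h3 : ϖ ^ (v + 1 + N) ∣ ϖ ^ (v + N) := by
    rw [← (w.isUnit).dvd_mul_left, pow_add ϖ v, ← mul_assoc]
    exact Ideal.mem_span_singleton.mp (neg_mem_iff.mp hmem)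
  have := (pow_dvd_pow_iff hϖ.ne_zero hϖ.not_isUnit).mp h3
  omega

end powerSeries

/-! ### Parameters and finiteness over a power series ring -/

section parameters

open MvPowerSeries

theorem IsDiscreteValuationRing.isUnit_or_dvd {C : Type*} [CommRing C] [IsDomain C]
    [IsDiscreteValuationRing C] {ϖ : C} (hϖ : Irreducible ϖ) (x : C) : IsUnit x ∨ ϖ ∣ x := by
  by_cases hx : x = 0
  · exact Or.inr (hx ▸ dvd_zero _)
  · obtain ⟨k, u, rfl⟩ := IsDiscreteValuationRing.eq_unit_mul_pow_irreducible hx hϖ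
    rcases k with _ | k
    · left; simp
    · right; exact Dvd.dvd.mul_left (dvd_pow_self _ k.succ_ne_zero) _

theorem MvPowerSeries.exists_eq_pow_smul_primitive {C σ : Type*} [CommRing C] [IsDomain C]
    [IsDiscreteValuationRing C] {ϖ : C} (hϖ : Irreducible ϖ) (f : MvPowerSeries σ C) (hf : f ≠ 0) :
    ∃ (k : ℕ) (g : MvPowerSeries σ C), f = ϖ ^ k • g ∧ ∃ d, IsUnit (coeff d g) := by
  classical
  obtain ⟨d₀, hd₀⟩ : ∃ d, coeff d f ≠ 0 := by
    by_contra! h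
    exact hf (MvPowerSeries.ext (by simpa using h))
  have hex : ∃ k d, ∃ u : Cˣ, coeff d f = u * ϖ ^ k :=
    let ⟨k, u, h⟩ := IsDiscreteValuationRing.eq_unit_mul_pow_irreducible hd₀ hϖ
    ⟨k, d₀, u, h⟩
  obtain ⟨d, u, hd⟩ := Nat.find_spec hex
  have hdvd : ∀ d, ∃ c, coeff d f = ϖ ^ Nat.find hex * c := by
    intro d
    by_cases h0 : coeff d f = 0
    · exact ⟨0, by simpa using h0⟩
    · obtain ⟨m, v, hm⟩ := IsDiscreteValuationRing.eq_unit_mul_pow_irreducible h0 hϖ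
      have := Nat.find_min' hex ⟨d, v, hm⟩
      rw [hm]
      exact Dvd.dvd.mul_left (pow_dvd_pow _ this) _
  choose g hg using hdvd
  refine ⟨Nat.find hex, fun d => g d, MvPowerSeries.ext fun d => ?_, d, ?_⟩
  · exact hg d
  · have : g d = u := by
      have h1 := (hg d).symm.trans hd
      rw [mul_comm] at h1
      exact mul_right_cancel₀ (pow_ne_zero _ hϖ.ne_zero) h1
    change IsUnit (g d)
    rw [this]
    exact u.isUnit

variable {R : Type*} [CommRing R] [IsLocalRing R] [IsNoetherianRing R]

/-- `ϖ` together with the family `r` generates an ideal primary to the maximal ideal. -/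
def IsParameterFamily (ϖ : R) {n : ℕ} (r : Fin n → R) : Prop :=
  (∀ i, r i ∈ maximalIdeal R) ∧ maximalIdeal R ≤ (Ideal.span (insert ϖ (Set.range r))).radical

theorem exists_minimal_isParameterFamily (ϖ : R) : ∃ (n : ℕ) (r : Fin n → R),
    IsParameterFamily ϖ r ∧ ∀ k < n, ∀ y : Fin k → R, ¬ IsParameterFamily ϖ y := by
  classical
  have hex : ∃ n, ∃ r : Fin n → R, IsParameterFamily ϖ r := by
    obtain ⟨n, s, hs⟩ := Submodule.fg_iff_exists_fin_generating_family.mp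
      (IsNoetherian.noetherian (maximalIdeal R))
    have hs' : Ideal.span (Set.range s) = maximalIdeal R := hs
    refine ⟨n, s, fun i => hs' ▸ Ideal.subset_span ⟨i, rfl⟩, ?_⟩
    rw [← hs']
    exact (Ideal.span_mono (Set.subset_insert _ _)).trans Ideal.le_radical
  obtain ⟨r, hr⟩ := Nat.find_spec hex
  exact ⟨_, r, hr, fun k hk y hy => Nat.find_min hex hk ⟨y, hy⟩⟩

variable [TopologicalSpace R] [IsTopologicalRing R] [CompactSpace R] [T2Space R]

/-- A relation among the `r i`, made primitive, would allow one parameter to be dropped. Modulo `ϖ`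
and the elements `r i - t ^ e i`, with `t` the last parameter, the relation has a unique lowest
term, a unit times `t ^ N`; so `t` is nilpotent modulo a family with one member fewer. -/
theorem injective_of_minimal_isParameterFamily [IsDomain R] {C : Type*} [CommRing C] [IsDomain C]
    [IsDiscreteValuationRing C] [Algebra C R] (hC : Function.Injective (algebraMap C R))
    {ϖ : C} (hϖ : Irreducible ϖ) {n : ℕ} {r : Fin n → R}
    (hr : IsParameterFamily (algebraMap C R ϖ) r)
    (hmin : ∀ k < n, ∀ y : Fin k → R, ¬ IsParameterFamily (algebraMap C R ϖ) y)
    (F : MvPowerSeries (Fin n) C →ₐ[C] R)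
    (hsum : ∀ f, HasSum (fun d => coeff d f • d.prod fun i e => r i ^ e) (F f)) :
    Function.Injective F := by
  refine (injective_iff_map_eq_zero F).mpr fun f₀ hf₀ => ?_
  by_contra hne
  obtain ⟨k, f, rfl, d₀, hd₀⟩ := exists_eq_pow_smul_primitive hϖ f₀ hne
  have hf : F f = 0 := by
    rw [map_smul, Algebra.smul_def] at hf₀
    exact (mul_eq_zero.mp hf₀).resolve_left
      ((map_ne_zero_iff _ hC).mpr (pow_ne_zero _ hϖ.ne_zero))
  obtain ⟨α, hα, e, he, he1, hlt⟩ := exists_weight_unique_minimizer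
    {α : Fin n → ℕ | IsUnit (coeff (Finsupp.equivFunOnFinite.symm α) f)} ⟨d₀, by simpa using hd₀⟩
  set α' := Finsupp.equivFunOnFinite.symm α with hα'
  have hterm : ∀ J : Ideal R, (∀ d ≠ α', coeff d f • (d.prod fun i e => r i ^ e) ∈ J) →
      (α'.prod fun i e => r i ^ e) ∈ J := by
    intro J hJ
    have := HasSum.sub_mem_of_isClosed (J := J.toAddSubgroup)
      (IsNoetherianRing.isClosed_ideal J) (hsum f) α' hJ
    rw [hf, zero_sub] at this
    have := neg_mem_iff.mp this
    rw [Algebra.smul_def] at this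
    exact (Ideal.unit_mul_mem_iff_mem J (IsUnit.map (algebraMap C R) hα)).mp this
  rcases n with _ | n
  · have := hterm ⊥ fun d hd => absurd (Subsingleton.elim _ _) hd
    rw [Finsupp.prod_fintype _ _ (by simp)] at this
    simp at this
  · set t := r (Fin.last n)
    set y : Fin n → R := fun i => r i.castSucc - t ^ e i.castSucc
    set J := Ideal.span (insert (algebraMap C R ϖ) (Set.range y))
    have hϖJ : algebraMap C R ϖ ∈ J := Ideal.subset_span (Set.mem_insert _ _)
    have hrt : ∀ i, Ideal.Quotient.mk J (r i) = Ideal.Quotient.mk J t ^ e i := by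
      intro i
      refine Fin.lastCases ?_ (fun i => ?_) i
      · rw [he1 (Fin.last n) rfl, pow_one]
      · rw [← map_pow, Ideal.Quotient.eq]
        exact Ideal.subset_span (Set.mem_insert_of_mem _ ⟨i, rfl⟩)
    have hprod : ∀ d : Fin (n + 1) →₀ ℕ,
        (d.prod fun i k => r i ^ k) - t ^ (∑ i, e i * d i) ∈ J := by
      intro d
      rw [← Ideal.Quotient.eq, Finsupp.prod_fintype _ _ (by simp), map_prod, map_pow,
        ← Finset.prod_pow_eq_pow_sum]
      exact Finset.prod_congr rfl fun i _ => by rw [map_pow, hrt, pow_mul]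
    set N := ∑ i, e i * α i
    have htm : t ∈ maximalIdeal R := hr.1 _
    have h1 : (α'.prod fun i k => r i ^ k) ∈ J ⊔ Ideal.span {t ^ (N + 1)} := by
      refine hterm _ fun d hd => ?_
      rw [Algebra.smul_def]
      rcases IsDiscreteValuationRing.isUnit_or_dvd hϖ (coeff d f) with hu | ⟨c, hc⟩
      · refine Ideal.mul_mem_left _ _ ?_
        have := hlt (Finsupp.equivFunOnFinite d) (by simpa using hu)
          (fun h => hd (by rw [hα', ← h]; simp))
        rw [← sub_add_cancel (d.prod fun i k => r i ^ k) (t ^ (∑ i, e i * d i))]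
        exact add_mem (Ideal.mem_sup_left (hprod d))
          (Ideal.mem_sup_right (Ideal.mem_span_singleton.mpr (pow_dvd_pow _ this)))
      · rw [hc, map_mul, mul_assoc]
        exact Ideal.mem_sup_left (Ideal.mul_mem_right _ _ hϖJ)
    have h2 : t ^ N ∈ J ⊔ Ideal.span {t ^ (N + 1)} := by
      have := sub_mem h1 (Ideal.mem_sup_left (hprod α'))
      rwa [sub_sub_cancel] at this
    have h3 : t ^ N ∈ J := by
      -- `t ^ N = a + t ^ (N + 1) z` with `a ∈ J`, and `1 - t z` is a unit.
      obtain ⟨a, ha, b, hb, hab⟩ := Submodule.mem_sup.mp h2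
      obtain ⟨z, rfl⟩ := Ideal.mem_span_singleton.mp hb
      have hu : IsUnit (1 - t * z) := isUnit_one_sub_self_of_mem_nonunits _
        ((mem_maximalIdeal _).mp (Ideal.mul_mem_right z (maximalIdeal R) htm))
      refine (Ideal.unit_mul_mem_iff_mem J hu).mp ?_
      rw [show (1 - t * z) * t ^ N = a by rw [← sub_eq_of_eq_add hab.symm]; ring]
      exact ha
    refine hmin n n.lt_succ_self y ⟨fun i => sub_mem (hr.1 _)
      (Ideal.pow_mem_of_mem _ htm _ (he _)), hr.2.trans ?_⟩
    refine Ideal.radical_le_radical_iff.mpr (Ideal.span_le.mpr ?_)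
    rintro _ (rfl | ⟨i, rfl⟩)
    · exact Ideal.le_radical hϖJ
    · have ht : t ∈ J.radical := ⟨N, h3⟩
      have h4 : r i - t ^ e i ∈ J := by
        rw [← Ideal.Quotient.eq, map_pow]; exact hrt i
      rw [← sub_add_cancel (r i) (t ^ e i)]
      exact add_mem (Ideal.le_radical h4) (Ideal.pow_mem_of_mem _ ht _ (he i))

/-- A compact form of Nakayama's lemma. -/
theorem Module.finite_of_le_radical_map {A : Type*} [CommRing A] [TopologicalSpace A]
    [CompactSpace A] [Algebra A R] (hA : Continuous (algebraMap A R))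
    (hR : IsAdic (maximalIdeal R)) (I : Ideal A) (hI : I.map (algebraMap A R) ≤ maximalIdeal R)
    (hrad : maximalIdeal R ≤ (I.map (algebraMap A R)).radical) : Module.Finite A R := by
  have : ContinuousSMul A R := ⟨by
    simp only [Algebra.smul_def]
    fun_prop⟩
  set J := I.map (algebraMap A R)
  have hfin : Finite (R ⧸ J) := by
    obtain ⟨k, hk⟩ := Ideal.exists_pow_le_of_le_radical_of_fg hrad
      (IsNoetherian.noetherian (maximalIdeal R))
    exact isOpen_iff_finite_quotient.mp (AddSubgroup.isOpen_mono
      (H₁ := (maximalIdeal R ^ k).toAddSubgroup) (H₂ := J.toAddSubgroup) hk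
      (isOpen_maximalIdeal_pow R k))
  -- Representatives of the finite ring `R ⧸ J` span a submodule `N` that is dense, by iteration
  -- modulo powers of `I`, and compact, hence everything.
  obtain ⟨s, hs⟩ := Function.Surjective.hasRightInverse (Ideal.Quotient.mk_surjective (I := J))
  let N : Submodule A R := Submodule.span A (Set.range s)
  have hNfg : N.FG := Submodule.fg_span (Set.finite_range s)
  have hNJ : (⊤ : Submodule A R) ≤ N ⊔ I • ⊤ := by
    intro x _
    rw [← sub_add_cancel x (s (Ideal.Quotient.mk J x)), add_comm]
    refine Submodule.add_mem_sup (Submodule.subset_span ⟨_, rfl⟩) ?_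
    rw [Ideal.smul_top_eq_map]
    exact Ideal.Quotient.eq.mp (hs _).symm
  have hpow : ∀ k : ℕ, (⊤ : Submodule A R) ≤ N ⊔ I ^ k • ⊤ := by
    intro k
    induction k with
    | zero => rw [pow_zero, Ideal.one_eq_top, Submodule.top_smul]; exact le_sup_right
    | succ k ih =>
      refine ih.trans (sup_le le_sup_left ?_)
      calc I ^ k • (⊤ : Submodule A R) ≤ I ^ k • (N ⊔ I • ⊤) := smul_mono_right _ hNJ
        _ = I ^ k • N ⊔ I ^ (k + 1) • ⊤ := by
          rw [Submodule.smul_sup, ← Submodule.mul_smul, pow_succ]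
        _ ≤ N ⊔ I ^ (k + 1) • ⊤ := sup_le_sup_right Submodule.smul_le_right _
  have hclosed : IsClosed (N : Set R) := (Submodule.isCompact_of_fg hNfg).isClosed
  refine ⟨?_⟩
  suffices h : N = ⊤ from h ▸ hNfg
  refine eq_top_iff.mpr fun x _ => ?_
  refine hclosed.closure_subset_iff.mpr le_rfl
    ((mem_closure_iff_nhds_basis (hR.hasBasis_nhds x)).mpr fun k _ => ?_)
  obtain ⟨a, ha, b, hb, rfl⟩ := Submodule.mem_sup.mp (hpow k (Submodule.mem_top (x := x)))
  refine ⟨a, ha, -b, neg_mem ?_, by simp⟩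
  rw [Ideal.smul_top_eq_map, Ideal.map_pow] at hb
  exact Ideal.pow_right_mono hI k hb

end parameters

/-! ### The adic topology on a module -/

section adicModule

variable {R : Type*} [CommRing R] (J : Ideal R) (W : Type*) [AddCommGroup W] [Module R W]

theorem Ideal.isTopologicalAddGroup_adicModuleTopology :
    @IsTopologicalAddGroup W (J.adicModuleTopology W) _ := by
  let := J.adic_basis.topology
  let B := (J.ringFilterBasis.moduleFilterBasis (J.adic_module_basis W))
  exact B.toAddGroupFilterBasis.isTopologicalAddGroup

theorem Ideal.hasBasis_nhds_zero_adicModuleTopology :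
    (@nhds W (J.adicModuleTopology W) 0).HasBasis (fun _ : ℕ => True)
      fun k => ((J ^ k • ⊤ : Submodule R W) : Set W) := by
  let := J.adic_basis.topology
  let B := (J.ringFilterBasis.moduleFilterBasis (J.adic_module_basis W))
  refine ⟨fun U => ?_⟩
  rw [B.toAddGroupFilterBasis.nhds_zero_hasBasis.mem_iff]
  constructor
  · rintro ⟨-, ⟨i, rfl⟩, h⟩
    exact ⟨i, trivial, h⟩
  · rintro ⟨i, -, h⟩
    exact ⟨_, ⟨i, rfl⟩, h⟩

theorem Ideal.continuousSMul_adicModuleTopology [TopologicalSpace R] [IsTopologicalRing R]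
    (hR : IsAdic J) :
    @ContinuousSMul R W _ _ (J.adicModuleTopology W) := by
  let := J.adicModuleTopology W
  have := J.isTopologicalAddGroup_adicModuleTopology W
  refine ContinuousSMul.of_basis_zero (J.hasBasis_nhds_zero_adicModuleTopology W) ?_ ?_ ?_
  · intro i _
    refine ⟨Set.univ, Filter.univ_mem, i, trivial, ?_⟩
    rintro _ ⟨a, -, m, hm, rfl⟩
    exact Submodule.smul_mem _ _ hm
  · intro x₀ i _
    exact ⟨i, trivial, fun m hm => Submodule.smul_mem _ _ hm⟩
  · intro m₀ i _
    filter_upwards [hR.hasBasis_nhds_zero.mem_of_mem (i := i) trivial] with x hx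
    exact Submodule.smul_mem_smul hx Submodule.mem_top

theorem Ideal.t2Space_adicModuleTopology [IsLocalRing R] [IsNoetherianRing R] [Module.Finite R W]
    (hJ : J ≠ ⊤) : @T2Space W (J.adicModuleTopology W) := by
  let := J.adicModuleTopology W
  have := J.isTopologicalAddGroup_adicModuleTopology W
  refine IsTopologicalAddGroup.t2Space_of_zero_sep fun x hx => ?_
  by_contra! h
  have : x ∈ (⨅ i : ℕ, J ^ i • ⊤ : Submodule R W) := (Submodule.mem_iInf _).mpr fun i =>
    h _ ((J.hasBasis_nhds_zero_adicModuleTopology W).mem_of_mem trivial)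
  rw [Ideal.iInf_pow_smul_eq_bot_of_isLocalRing _ hJ] at this
  exact hx this

theorem Ideal.compactSpace_adicModuleTopology [TopologicalSpace R] [IsTopologicalRing R]
    [CompactSpace R] [Module.Finite R W] (hR : IsAdic J) :
    @CompactSpace W (J.adicModuleTopology W) := by
  let := J.adicModuleTopology W
  have := J.isTopologicalAddGroup_adicModuleTopology W
  have := J.continuousSMul_adicModuleTopology W hR
  exact ⟨Submodule.isCompact_of_fg (Module.Finite.fg_top (R := R))⟩

end adicModule

/-! ### Rescaling the variables -/

section rescale

open MvPowerSeries MvPowerSeries.WithPiTopology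

variable {C σ : Type*} [CommRing C]

theorem MvPowerSeries.rescale_injective [IsDomain C] {a : σ → C} (ha : ∀ i, a i ≠ 0) :
    Function.Injective (rescale a) := by
  refine (injective_iff_map_eq_zero (rescale a)).mpr fun f hf => MvPowerSeries.ext fun d => ?_
  have h1 := congrArg (coeff d) hf
  rw [coeff_rescale, map_zero] at h1
  exact (mul_eq_zero.mp h1).resolve_left
    (Finset.prod_ne_zero_iff.mpr fun i _ => pow_ne_zero _ (ha i))

theorem MvPowerSeries.continuous_rescale [TopologicalSpace C] [IsTopologicalRing C] (a : σ → C) :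
    Continuous (rescale a) := by
  refine continuous_pi fun d => ?_
  have : (fun f : MvPowerSeries σ C => rescale a f d) =
      fun f => (d.prod fun i k => a i ^ k) * coeff d f := funext fun f => coeff_rescale f a d
  rw [this]
  exact continuous_const.mul (continuous_coeff C d)

theorem MvPowerSeries.exists_rescale_eq_add_smul (c : C) (f : MvPowerSeries σ C) :
    ∃ g : MvPowerSeries σ C,
      rescale (fun _ => c) f = algebraMap C _ (constantCoeff f) + c • g := by
  classical
  have hdvd : ∀ d : σ →₀ ℕ, d ≠ 0 → c ∣ d.prod fun _ k => c ^ k := by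
    intro d hd
    obtain ⟨i, hi⟩ := Finsupp.ne_iff.mp hd
    exact (dvd_pow_self _ hi).trans
      (Finset.dvd_prod_of_mem (fun i => c ^ d i) (Finsupp.mem_support_iff.mpr hi))
  have hex : ∀ d : σ →₀ ℕ, ∃ y, coeff d (rescale (fun _ => c) f) =
      coeff d (algebraMap C (MvPowerSeries σ C) (constantCoeff f)) + c * y := by
    intro d
    rw [coeff_rescale, MvPowerSeries.algebraMap_apply, coeff_C]
    by_cases hd : d = 0
    · subst hd
      exact ⟨0, by simp⟩
    · obtain ⟨y, hy⟩ := hdvd d hd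
      exact ⟨y * coeff d f, by rw [hy, if_neg hd]; simp [mul_assoc]⟩
  choose g hg using hex
  exact ⟨g, MvPowerSeries.ext hg⟩

end rescale

/-! ### Matrix coordinates on `W` -/

section coordinates

variable {R : Type*} [CommRing R] [IsDomain R] [IsLocalRing R] [IsNoetherianRing R]
  [TopologicalSpace R] [IsTopologicalRing R]
  {W : Type*} [AddCommGroup W] [Module R W] [Module.Finite R W] [Module.IsTorsionFree R W]

/-- Continuous coordinates on `W` in which every endomorphism of `W` acts through a matrix. -/
def HasMatrixCoordinates (R W : Type*) [CommRing R] [IsLocalRing R] [TopologicalSpace R]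
    [AddCommGroup W] [Module R W] : Prop :=
  ∃ (s : ℕ) (lam : W →+ (Fin s → R)) (l : Fin s → W),
    @Continuous _ _ ((maximalIdeal R).adicModuleTopology W) _ lam ∧ Function.Injective lam ∧
    (∀ i, lam (l i) = Pi.single i 1) ∧ ∀ (g : W →ₗ[R] W) (w : W),
      lam (g w) = (Matrix.of fun i k => lam (g (l k)) i).mulVec (lam w)

theorem hasMatrixCoordinates_of_finite {A C : Type*} [CommRing A] [IsDomain A] [TopologicalSpace A]
    [CompactSpace A] [CommRing C] [IsDomain C] [IsPrincipalIdealRing C] [Algebra A R]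
    [Module.Finite A R] (hR : IsAdic (maximalIdeal R)) (hA : Continuous (algebraMap A R))
    (hAinj : Function.Injective (algebraMap A R)) (j : C →+* R) (hj : Function.Injective j)
    (H : ∀ c : A, c ≠ 0 → ∃ (ev : A →+* C) (φ : A →+* R), Function.Surjective ev ∧
      Function.Injective φ ∧ Continuous φ ∧ ev c ≠ 0 ∧
      ∀ f, ∃ z ∈ maximalIdeal R, φ f = j (ev f) + j (ev c) * z) :
    HasMatrixCoordinates R W := by
  let : Module A W := Module.compHom W (algebraMap A R)
  have : IsScalarTower A R W := ⟨fun a r w => by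
    rw [Algebra.smul_def, mul_smul]; rfl⟩
  have : Module.Finite A W := Module.Finite.trans R W
  have : Module.IsTorsionFree A W := by
    refine .of_smul_eq_zero fun a w h => ?_
    rw [← algebraMap_smul R a w] at h
    exact (smul_eq_zero.mp h).imp_left fun h => hAinj (h.trans (map_zero _).symm)
  obtain ⟨s, φ, lam, l, hφ, hφc, hsemi, hlam, hl, hspan⟩ :=
    exists_semilinear_coordinates (W := W) j hj (fun φ => Continuous φ) H
  refine ⟨s, lam, l, ?_, hlam, hl, fun g w =>
    semilinear_coordinates_apply hφ hsemi hl hspan (g.restrictScalars A) w⟩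
  let := (maximalIdeal R).adicModuleTopology W
  have := (maximalIdeal R).isTopologicalAddGroup_adicModuleTopology W
  have := (maximalIdeal R).continuousSMul_adicModuleTopology W hR
  have := (maximalIdeal R).t2Space_adicModuleTopology W (Ideal.IsPrime.ne_top inferInstance)
  obtain ⟨n, v, hv⟩ := Module.Finite.exists_fin (R := A) (M := W)
  let q : (Fin n → A) → W := fun a => ∑ i, algebraMap A R (a i) • v i
  have hq : Continuous q := by fun_prop
  have hqs : Function.Surjective q := by
    intro w
    have : w ∈ Submodule.span A (Set.range v) := hv ▸ Submodule.mem_top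
    obtain ⟨a, ha⟩ := (Submodule.mem_span_range_iff_exists_fun A).mp this
    exact ⟨a, by simpa [q] using ha⟩
  -- `W` is a quotient of the compact space `A^n`, so continuity of `lam` can be tested there, where
  -- it is explicit in `φ`.
  refine (hq.isClosedMap.isQuotientMap hq hqs).continuous_iff.mpr ?_
  have : lam ∘ q = fun a => ∑ i, φ (a i) • lam (v i) := by
    ext a : 1
    simp only [Function.comp_apply, q, map_sum, algebraMap_smul, hsemi]
  rw [this]
  fun_prop

variable [CompactSpace R] [T2Space R]

open MvPowerSeries MvPowerSeries.WithPiTopology in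
theorem hasMatrixCoordinates_of_ne_bot {p : ℕ} (hp : p.Prime) (hpm : (p : R) ∈ maximalIdeal R)
    (hR : IsAdic (maximalIdeal R)) (hbot : maximalIdeal R ≠ ⊥) : HasMatrixCoordinates R W := by
  -- The uniformizer is `p` if `p ≠ 0` in `R`, and otherwise any nonzero element of `𝔪`.
  obtain ⟨t, htm, ht0, hpt⟩ : ∃ t ∈ maximalIdeal R, t ≠ 0 ∧
      ∃ d ∈ Subring.closure {t}, (p : R) = t * d := by
    by_cases hp0 : (p : R) = 0
    · obtain ⟨t, ht, ht0⟩ := Submodule.exists_mem_ne_zero_of_ne_bot hbot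
      exact ⟨t, ht, ht0, 0, zero_mem _, by simpa using hp0⟩
    · exact ⟨p, hpm, hp0, 1, one_mem _, (mul_one _).symm⟩
  obtain ⟨hdvr, hirr⟩ := isDiscreteValuationRing_coefficientSubring hp hR htm ht0 hpt
  have := hR.isLinearTopology
  have := (coefficientSubring t).isLinearTopology
  set C := coefficientSubring t
  set ϖ : C := ⟨t, mem_coefficientSubring t⟩
  have htop : ∀ x ∈ maximalIdeal R, IsTopologicallyNilpotent x := by
    intro x hx
    refine (hR.hasBasis_nhds_zero.tendsto_right_iff).mpr fun N _ => ?_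
    filter_upwards [Filter.eventually_ge_atTop N] with n hn
    exact Ideal.pow_le_pow_right hn (Ideal.pow_mem_pow hx n)
  have hϖnil : IsTopologicallyNilpotent ϖ := by
    have := htop t htm
    rw [IsTopologicallyNilpotent, nhds_subtype_eq_comap, Filter.tendsto_comap_iff]
    exact this
  have hCinj : Function.Injective (algebraMap C R) := Subtype.val_injective
  have : ContinuousSMul C R := ⟨by
    simp only [Algebra.smul_def]
    exact (continuous_subtype_val.comp continuous_fst).mul continuous_snd⟩
  obtain ⟨n, r, hr, hmin⟩ := exists_minimal_isParameterFamily (algebraMap C R ϖ)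
  obtain ⟨F, hF, hFX, hsum⟩ := exists_continuous_algHom (C := C) r fun i => htop _ (hr.1 i)
  have hFinj := injective_of_minimal_isParameterFamily hCinj hirr hr hmin F hsum
  let := F.toRingHom.toAlgebra
  have : IsDomain (MvPowerSeries (Fin n) C) := hFinj.isDomain F.toRingHom
  have : Module.Finite (MvPowerSeries (Fin n) C) R := by
    have hmap : (Ideal.span (insert (algebraMap C _ ϖ) (Set.range X))).map
        (algebraMap (MvPowerSeries (Fin n) C) R) =
        Ideal.span (insert (algebraMap C R ϖ) (Set.range r)) := by
      rw [Ideal.map_span, Set.image_insert_eq, ← Set.range_comp]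
      congr 2
      · exact F.commutes ϖ
      · exact congrArg _ (funext hFX)
    refine Module.finite_of_le_radical_map hF hR _ ?_ (hmap ▸ hr.2)
    rw [hmap, Ideal.span_le]
    rintro _ (rfl | ⟨i, rfl⟩)
    · exact htm
    · exact hr.1 i
  refine hasMatrixCoordinates_of_finite hR hF hFinj (algebraMap C R) hCinj fun c hc => ?_
  obtain ⟨ψ, hψ, hψinj, hψc⟩ := exists_translation_constantCoeff_ne_zero hirr hϖnil c hc
  set c₀ := constantCoeff (ψ c)
  have hres : Function.Injective (rescale fun _ : Fin n => ϖ * c₀) :=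
    rescale_injective fun _ => mul_ne_zero hirr.ne_zero hψc
  -- Rescaling by `c₀` alone would give agreement modulo `c₀ R`; the extra `ϖ` puts the error in `c₀
  -- 𝔪`.
  refine ⟨constantCoeff.comp ψ.toRingHom,
    F.toRingHom.comp ((rescale fun _ => ϖ * c₀).comp ψ.toRingHom), ?_, ?_, ?_, ?_, ?_⟩
  · intro x
    refine ⟨algebraMap C _ x, ?_⟩
    change constantCoeff (ψ (algebraMap C _ x)) = x
    rw [AlgHom.commutes]
    simp [MvPowerSeries.algebraMap_apply]
  · exact hFinj.comp (hres.comp hψinj)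
  · exact hF.comp ((continuous_rescale _).comp hψ)
  · exact hψc
  · intro f
    obtain ⟨g, hg⟩ := exists_rescale_eq_add_smul (ϖ * c₀) (ψ f)
    refine ⟨t * F g, Ideal.mul_mem_right _ _ htm, ?_⟩
    change F (rescale (fun _ => ϖ * c₀) (ψ f)) = _
    rw [hg, map_add, AlgHom.commutes, map_smul, Algebra.smul_def, map_mul]
    change algebraMap C R (constantCoeff (ψ f)) + (t * algebraMap C R c₀) * F g =
      algebraMap C R (constantCoeff (ψ f)) + algebraMap C R c₀ * (t * F g)
    ring

theorem hasMatrixCoordinates {p : ℕ} (hp : p.Prime) (hpm : (p : R) ∈ maximalIdeal R)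
    (hR : IsAdic (maximalIdeal R)) : HasMatrixCoordinates R W := by
  by_cases hbot : maximalIdeal R = ⊥
  · have := (isField_iff_maximalIdeal_eq.mpr hbot).isPrincipalIdealRing
    exact hasMatrixCoordinates_of_finite (A := R) (C := R) hR continuous_id
      Function.injective_id (RingHom.id R) Function.injective_id fun c hc =>
        ⟨RingHom.id R, RingHom.id R, Function.surjective_id, Function.injective_id, continuous_id,
          hc, fun f => ⟨0, zero_mem _, by simp⟩⟩
  · exact hasMatrixCoordinates_of_ne_bot hp hpm hR hbot

end coordinates

/-! ### Compactness of the automorphism group and the embedding -/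

section automorphisms

variable {R : Type*} [CommRing R] [IsLocalRing R] [IsNoetherianRing R]
  [TopologicalSpace R] [IsTopologicalRing R] [CompactSpace R]
  {W : Type*} [AddCommGroup W] [Module R W] [Module.Finite R W]

/-- The pointwise limits of automorphisms are automorphisms. -/
theorem compactSpace_linearEquiv (hR : IsAdic (maximalIdeal R)) : CompactSpace (W ≃ₗ[R] W) := by
  let := (maximalIdeal R).adicModuleTopology W
  have := (maximalIdeal R).isTopologicalAddGroup_adicModuleTopology W
  have := (maximalIdeal R).continuousSMul_adicModuleTopology W hR
  have := (maximalIdeal R).t2Space_adicModuleTopology W (Ideal.IsPrime.ne_top inferInstance)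
  have := (maximalIdeal R).compactSpace_adicModuleTopology W hR
  have hind : IsInducing (fun (g : W ≃ₗ[R] W) (w : W) => g w) := ⟨rfl⟩
  refine (hind.isCompact_iff (s := Set.univ)).mpr ?_ |> isCompact_univ_iff.mp
  rw [Set.image_univ]
  refine IsClosed.isCompact (isClosed_of_closure_subset fun f hf => ?_)
  have hadd : ∀ x y, f (x + y) = f x + f y := by
    intro x y
    have : IsClosed {f : W → W | f (x + y) = f x + f y} :=
      isClosed_eq (by fun_prop) (by fun_prop)
    refine closure_minimal ?_ this hf
    rintro _ ⟨g, rfl⟩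
    exact map_add g x y
  have hsmul : ∀ (a : R) x, f (a • x) = a • f x := by
    intro a x
    have : IsClosed {f : W → W | f (a • x) = a • f x} :=
      isClosed_eq (by fun_prop) (by fun_prop)
    refine closure_minimal ?_ this hf
    rintro _ ⟨g, rfl⟩
    exact map_smul g a x
  let f' : W →ₗ[R] W := ⟨⟨f, hadd⟩, hsmul⟩
  obtain ⟨n, v, hv⟩ := Module.Finite.exists_fin (R := R) (M := W)
  have hmem : ((maximalIdeal R ^ 1 • ⊤ : Submodule R W) : Set W) ∈ 𝓝 (0 : W) :=
    ((maximalIdeal R).hasBasis_nhds_zero_adicModuleTopology W).mem_of_mem (i := 1) trivial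
  rw [pow_one] at hmem
  have hnhds : {h : W → W | ∀ i, h (v i) - f (v i) ∈ (maximalIdeal R • ⊤ : Submodule R W)} ∈
      𝓝 f := by
    simp only [Set.ofPred_forall]
    refine (Filter.iInter_mem).mpr fun i => ?_
    have hc : Continuous fun h : W → W => h (v i) - f (v i) := by fun_prop
    exact hc.continuousAt.preimage_mem_nhds (by simpa using hmem)
  obtain ⟨_, hg, g, rfl⟩ := mem_closure_iff_nhds.mp hf _ hnhds
  have hsub : ∀ w, g w - f' w ∈ (maximalIdeal R • ⊤ : Submodule R W) := by
    intro w
    have hw : w ∈ Submodule.span R (Set.range v) := hv ▸ Submodule.mem_top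
    induction hw using Submodule.span_induction with
    | mem x hx => obtain ⟨i, rfl⟩ := hx; exact hg i
    | zero => simp
    | add x y _ _ hx hy => rw [map_add, map_add, add_sub_add_comm]; exact add_mem hx hy
    | smul a x _ hx => rw [map_smul, map_smul, ← smul_sub]; exact Submodule.smul_mem _ _ hx
  -- The limit `f'` agrees modulo `𝔪 W` with an automorphism `g`, so Nakayama's lemma gives
  -- surjectivity.
  have hsurj : Function.Surjective f' := by
    rw [← LinearMap.range_eq_top, eq_top_iff]
    refine Submodule.le_of_le_smul_of_le_jacobson_bot (I := maximalIdeal R) Module.Finite.fg_top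
      (maximalIdeal_le_jacobson _) fun w _ => ?_
    obtain ⟨x, rfl⟩ := g.surjective w
    rw [← sub_add_cancel (g x) (f' x), add_comm]
    exact Submodule.add_mem_sup ⟨x, rfl⟩ (hsub x)
  have hbij : Function.Bijective f' :=
    ⟨OrzechProperty.injective_of_surjective_endomorphism f' hsurj, hsurj⟩
  exact ⟨LinearEquiv.ofBijective f' hbij, rfl⟩

variable [T2Space R]

theorem exists_isClosedEmbedding_generalLinearGroup (hR : IsAdic (maximalIdeal R))
    (h : HasMatrixCoordinates R W) :
    ∃ (n : ℕ) (ρ : (W ≃ₗ[R] W) →* Matrix.GeneralLinearGroup (Fin n) R), IsClosedEmbedding ρ := by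
  obtain ⟨s, lam, l, hcont, hinj, hl, hmat⟩ := h
  let M : (W ≃ₗ[R] W) →* Matrix (Fin s) (Fin s) R :=
    { toFun := fun g => Matrix.of fun i k => lam (g (l k)) i
      map_one' := by
        ext i k
        simp [hl, Matrix.one_apply, Pi.single_apply]
      map_mul' := fun g h => by
        ext i k
        exact congrFun (hmat g.toLinearMap (h (l k))) i }
  have hM : ∀ g w, lam (g w) = (M g).mulVec (lam w) := fun g w => hmat g.toLinearMap w
  have hMcont : Continuous M := by
    refine continuous_matrix fun i k => ?_
    let := (maximalIdeal R).adicModuleTopology W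
    have h1 : Continuous fun (g : W ≃ₗ[R] W) (w : W) => g w := continuous_induced_dom
    exact (continuous_apply i).comp (hcont.comp ((continuous_apply (l k)).comp h1))
  have hMinj : Function.Injective M := by
    intro g h hgh
    refine LinearEquiv.ext fun w => hinj ?_
    rw [hM, hM, hgh]
  have := compactSpace_linearEquiv (W := W) hR
  have : CompactSpace (Matrix (Fin s) (Fin s) R) :=
    inferInstanceAs (CompactSpace (Fin s → Fin s → R))
  -- By compactness of the matrix ring, continuity into `GL_s(R)` needs no check on inverses.
  have hval : IsClosedEmbedding (Units.val : Matrix.GeneralLinearGroup (Fin s) R → _) :=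
    Units.continuous_val.isClosedEmbedding Units.val_injective
  refine ⟨s, M.toHomUnits, Continuous.isClosedEmbedding ?_ ?_⟩
  · exact hval.isInducing.continuous_iff.mpr hMcont
  · exact fun g h hgh => hMinj (congrArg Units.val hgh)

theorem isLinearOver_of_hasMatrixCoordinates (hR : IsAdic (maximalIdeal R))
    (h : HasMatrixCoordinates R W) (G : Subgroup (W ≃ₗ[R] W)) : IsLinearOver G R := by
  obtain ⟨n, ρ, hρ⟩ := exists_isClosedEmbedding_generalLinearGroup hR h
  refine ⟨n, ρ.comp G.subtype, hρ.isEmbedding.comp .subtypeVal, fun hG => ?_⟩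
  rw [MonoidHom.coe_comp, Set.range_comp, Subgroup.coe_subtype, Subtype.range_coe]
  exact hρ.isClosedMap _ hG

end automorphisms

theorem mainTheorem4 {p : ℕ} (hp : p.Prime) {R : Type u} [CommRing R] [IsDomain R] [IsLocalRing R]
    [IsNoetherianRing R] [TopologicalSpace R] (hR : IsProPRing p R)
    {W : Type v} [AddCommGroup W] [Module R W] [Module.Finite R W] [Module.IsTorsionFree R W]
    (G : Subgroup (W ≃ₗ[R] W)) :
    (∃ (S : Type u) (_ : CommRing S) (_ : TopologicalSpace S),
      IsNoetherianLocalProPDomain p S ∧ ringChar S = ringChar R ∧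
        ringKrullDim S = ringKrullDim R ∧ IsLinearOver G S) ∧
    (IsRegularLocalRing R → IsLinearOver G R) := by
  have := hR.isTopologicalRing
  have := hR.compactSpace
  have := hR.t2Space
  have hlin : IsLinearOver G R := isLinearOver_of_hasMatrixCoordinates hR.isAdic_maximalIdeal
    (hasMatrixCoordinates hp hR.natCast_mem_maximalIdeal hR.isAdic_maximalIdeal) G
  exact ⟨⟨R, inferInstance, inferInstance, ⟨inferInstance, inferInstance, inferInstance, hR⟩,
    rfl, rfl, hlin⟩, fun _ => hlin⟩
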